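/- Conventions. A graph is a finite undirected graph without multiple edges, possibly with loops. A bilabelled graph $\mathbf K=(K,\mathbf a,\mathbf b)\in\mathscr G(k,l)$ is a graph $K$ with a $k$-tuple $\mathbf a$ of input vertices and an $l$-tuple $\mathbf b$ of output vertices, taken up to isomorphism. For $\mathbf K=(K,\mathbf a,\mathbf b)$ and $\mathbf H=(H,\mathbf c,\mathbf d)$: - the tensor product is $\mathbf K\otimes\mathbf H=(K\sqcup H,\mathbf a\mathbf c,\mathbf b\mathbf d)$, and the involution is $\mathbf K^*=(K,\mathbf b,\mathbf a)$; - if $|\mathbf b|=|\mathbf c|$, the composition $\mathbf H\mathbf K$ is obtained from $K\sqcup H$ by identifying $b_i$ with $c_i$ for all $i$, with inputs $\mathbf a$ and outputs $\mathbf d$; - for an injective partial function $f\colon V(K)\to V(H)$, the $f$-union is $\mathbf K\cup_f\mathbf H=(K\cup_f H,\mathbf a\mathbf c,\mathbf b\mathbf d)$, where $K\cup_f H$ is the quotient of $K\sqcup H$ identifying the pairs in $f$; - for a partition $\pi$ of $V(K)$ with quotient map $q_\pi$, the quotient is $(K/\pi,q_\pi(\mathbf a),q_\pi(\mathbf b))$;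 two blocks are adjacent if some of their elements are. Let $\mathbf M^{k,l}$ be the edgeless graph on one vertex, which is $k$ times an input and $l$ times an output, and let $\mathbf 0$ be the null graph with empty tuples. A skew graph category is a set $\mathscr C$ of bilabelled graphs containing $\mathbf 0,\mathbf M^{1,1},\mathbf M^{0,2}$ and closed under all $f$-unions, involution, and those compositions $\mathbf H\mathbf K$ with $\ker\mathbf b=\ker\mathbf c$ (that is, $b_i=b_j\Leftrightarrow c_i=c_j$). A group-theoretical graph category is a set of bilabelled graphs containing $\mathbf 0,\mathbf M^{1,1},\mathbf M^{0,2}$ and closed under tensor products, all compositions, involution and quotients. For a graph $G$ with $n$ vertices and $\mathbf K\in\mathscr G(k,l)$, let $\hat T^G_{\mathbf K}\colon(\mathbb C^n)^{\otimes k}\to(\mathbb C^n)^{\otimes l}$ be the linear map whose $(\mathbf j,\mathbf i)$ entry is the number of injective homomorphisms $\phi\colon K\to G$ with $\phi(\mathbf a)=\mathbf i$ and $\phi(\mathbf b)=\mathbf j$, and put $\mathscr C^G(k,l)=\operatorname{span}\{\hat T^G_{\mathbf K}\mid\mathbf K\in\mathscr C(k,l)\}$. Let $\mathbb Z_2^{*V(G)}$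 be the free product of copies of $\mathbb Z_2$ with generators indexed by $V(G)$; maps $V(G)\to V(G)$ induce endomorphisms of it. An $\operatorname{Aut}G$-invariant (resp. $\operatorname{End}G$-invariant) quotient is a quotient $\Gamma=\mathbb Z_2^{*V(G)}/A$ by a normal subgroup $A$ with $\phi(A)\subseteq A$ for all automorphisms (resp. all homomorphisms) $\phi\colon G\to G$. For an $\operatorname{Aut}G$-invariant quotient $\Gamma$, let $\mathbb G=\hat\Gamma\rtimes\operatorname{Aut}G$ be the orthogonal compact matrix quantum group with $O(\mathbb G)=\mathbb C\Gamma\otimes O(\operatorname{Aut}G)$ and fundamental representation $u_{ij}=\gamma_i\otimes v_{ij}$ ($i,j\in V(G)$), where $\gamma_i\in\mathbb C\Gamma$ is the image of the $i$-th generator and $v_{ij}(\sigma)=\delta_{i\,\sigma(j)}$. Its representation category consists of the spaces $\mathfrak C_{\mathbb G}(k,l)=\{T\colon(\mathbb C^n)^{\otimes k}\to(\mathbb C^n)^{\otimes l}\mid Tu^{\otimes k}=u^{\otimes l}T\}$. Proposition. Let $G$ be a graph, let $\Gamma$ be an $\operatorname{Aut}G$-invariant quotient of $\mathbb Z_2^{*V(G)}$,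 and let $\mathbb G=\hat\Gamma\rtimes\operatorname{Aut}G$. 1. There is a skew graph category $\mathscr C$ such that $\mathscr C^G(k,l)=\mathfrak C_{\mathbb G}(k,l)$ for all $k,l\in\mathbb N_0$. 2. If $\Gamma$ is moreover $\operatorname{End}G$-invariant, then there is a skew graph category $\mathscr C$ that is a group-theoretical graph category, such that $\mathscr C^G(k,l)=\mathfrak C_{\mathbb G}(k,l)$ for all $k,l\in\mathbb N_0$. -/

import Mathlib

open scoped TensorProduct

universe u

/-! ## Graphs -/

/-- An undirected graph on `V` without multiple edges; loops are allowed. -/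
@[ext]
structure LoopGraph (V : Type u) where
  Adj : V → V → Prop
  symm : ∀ v w, Adj v w → Adj w v

namespace LoopGraph

variable {V W : Type u}

/-- The edgeless graph. -/
def edgeless (V : Type u) : LoopGraph V where
  Adj _ _ := False
  symm _ _ h := h

/-- `φ` is a graph homomorphism `K → G`. -/
def IsHom (K : LoopGraph V) (G : LoopGraph W) (φ : V → W) : Prop :=
  ∀ v w, K.Adj v w → G.Adj (φ v) (φ w)

/-- `e` is a graph isomorphism `K ≅ G`. -/
def IsIso (K : LoopGraph V) (G : LoopGraph W) (e : V ≃ W) : Prop :=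
  ∀ v w, K.Adj v w ↔ G.Adj (e v) (e w)

/-- The automorphism group of a graph, as a group of permutations of the vertices. -/
def Aut (G : LoopGraph V) : Subgroup (Equiv.Perm V) where
  carrier := {σ | G.IsIso G σ}
  one_mem' := fun _ _ => Iff.rfl
  mul_mem' := fun {a b} ha hb v w => (hb v w).trans (ha (b v) (b w))
  inv_mem' := fun {a} ha v w => by
    have h := ha (a⁻¹ v) (a⁻¹ w)
    simpa using h.symm

/-- The quotient graph `K / π`; a partition of the vertex set is an equivalence relation. -/
def quot (K : LoopGraph V) (π : Setoid V) : LoopGraph (Quotient π) where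
  Adj x y := ∃ v w, Quotient.mk π v = x ∧ Quotient.mk π w = y ∧ K.Adj v w
  symm := by
    rintro x y ⟨v, w, hv, hw, h⟩
    exact ⟨w, v, hw, hv, K.symm v w h⟩

/-- The disjoint union `K ⊔ H`. -/
def disjUnion (K : LoopGraph V) (H : LoopGraph W) : LoopGraph (V ⊕ W) where
  Adj := Sum.LiftRel K.Adj H.Adj
  symm := by
    rintro _ _ (h | h)
    · exact Sum.LiftRel.inl (K.symm _ _ h)
    · exact Sum.LiftRel.inr (H.symm _ _ h)

end LoopGraph

/-- The smallest equivalence relation on `V ⊔ W` that identifies `v` with `w` for all pairs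
`(v, w)` related by `R`. -/
def glueSetoid {V W : Type u} (R : V → W → Prop) : Setoid (V ⊕ W) :=
  Relation.EqvGen.setoid fun x y => ∃ v w, x = Sum.inl v ∧ y = Sum.inr w ∧ R v w

/-- A vertex overlap: an injective partial function from `V` to `W`, as a relation. -/
structure IsVertexOverlap {V W : Type u} (f : V → W → Prop) : Prop where
  right_unique : ∀ v w w', f v w → f v w' → w = w'
  left_unique : ∀ v v' w, f v w → f v' w → v = v'

/-! ## Bilabelled graphs and their categories -/

/-- A finite graph together with `k` input vertices and `l` output vertices. -/
structure BilabelledGraph (k l : ℕ) where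
  V : Type u
  finite : Finite V
  graph : LoopGraph V
  inp : Fin k → V
  out : Fin l → V

namespace BilabelledGraph

variable {k l m k' l' : ℕ}

instance (K : BilabelledGraph.{u} k l) : Finite K.V := K.finite

/-- Isomorphism of bilabelled graphs. -/
def Iso (K H : BilabelledGraph.{u} k l) : Prop :=
  ∃ e : K.V ≃ H.V, K.graph.IsIso H.graph e ∧ (∀ i, e (K.inp i) = H.inp i) ∧
    ∀ j, e (K.out j) = H.out j

/-- The null graph with empty tuples of inputs and outputs. -/
def null : BilabelledGraph.{u} 0 0 where
  V := PEmpty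
  finite := inferInstance
  graph := LoopGraph.edgeless PEmpty
  inp := Fin.elim0
  out := Fin.elim0

/-- The edgeless graph with a single vertex, which is `k` times an input and `l` times an
output. -/
def single (k l : ℕ) : BilabelledGraph.{u} k l where
  V := PUnit
  finite := inferInstance
  graph := LoopGraph.edgeless PUnit
  inp := fun _ => PUnit.unit
  out := fun _ => PUnit.unit

/-- The tensor product `(K ⊔ H, ac, bd)`. -/
def tensor (K : BilabelledGraph.{u} k l) (H : BilabelledGraph.{u} k' l') :
    BilabelledGraph.{u} (k + k') (l + l') where
  V := K.V ⊕ H.V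
  finite := inferInstance
  graph := K.graph.disjUnion H.graph
  inp := Fin.append (fun i => Sum.inl (K.inp i)) (fun i => Sum.inr (H.inp i))
  out := Fin.append (fun j => Sum.inl (K.out j)) (fun j => Sum.inr (H.out j))

/-- The quotient `(K / π, q(a), q(b))`. -/
def quot (K : BilabelledGraph.{u} k l) (π : Setoid K.V) : BilabelledGraph.{u} k l where
  V := Quotient π
  finite := inferInstance
  graph := K.graph.quot π
  inp := fun i => Quotient.mk π (K.inp i)
  out := fun j => Quotient.mk π (K.out j)

/-- The union `(K ∪_f H, ac, bd)` along a relation `f` (in applications, a vertex overlap). -/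
def union (K : BilabelledGraph.{u} k l) (H : BilabelledGraph.{u} k' l')
    (f : K.V → H.V → Prop) : BilabelledGraph.{u} (k + k') (l + l') :=
  (K.tensor H).quot (glueSetoid f)

/-- The composition `H · K = (H · K, a, d)` of `K = (K, a, b)` and `H = (H, c, d)`: in the
disjoint union, `b i` is identified with `c i` for every `i`. -/
def comp (H : BilabelledGraph.{u} l m) (K : BilabelledGraph.{u} k l) :
    BilabelledGraph.{u} k m where
  V := Quotient (glueSetoid fun v w => ∃ i, v = K.out i ∧ w = H.inp i)
  finite := inferInstance
  graph := (K.graph.disjUnion H.graph).quot _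
  inp := fun i => Quotient.mk _ (Sum.inl (K.inp i))
  out := fun j => Quotient.mk _ (Sum.inr (H.out j))

/-- The involution `(K, b, a)`. -/
def invol (K : BilabelledGraph.{u} k l) : BilabelledGraph.{u} l k where
  V := K.V
  finite := K.finite
  graph := K.graph
  inp := K.out
  out := K.inp

end BilabelledGraph

/-- A collection of bilabelled graphs with `k` inputs and `l` outputs, for all `k` and `l`. -/
abbrev GraphFamily : Type (u + 1) := (k l : ℕ) → Set (BilabelledGraph.{u} k l)

/-- Skew graph categories. Bilabelled graphs are considered up to isomorphism. -/
structure IsSkewGraphCategory (C : GraphFamily.{u}) : Prop where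
  iso_mem : ∀ {k l : ℕ} (K H : BilabelledGraph.{u} k l), K.Iso H → K ∈ C k l → H ∈ C k l
  null_mem : BilabelledGraph.null ∈ C 0 0
  identity_mem : BilabelledGraph.single 1 1 ∈ C 1 1
  pair_mem : BilabelledGraph.single 0 2 ∈ C 0 2
  union_mem : ∀ {k l k' l' : ℕ} (K : BilabelledGraph.{u} k l) (H : BilabelledGraph.{u} k' l')
    (f : K.V → H.V → Prop), IsVertexOverlap f → K ∈ C k l → H ∈ C k' l' →
      K.union H f ∈ C (k + k') (l + l')
  comp_mem : ∀ {k l m : ℕ} (K : BilabelledGraph.{u} k l) (H : BilabelledGraph.{u} l m),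
    Setoid.ker K.out = Setoid.ker H.inp → K ∈ C k l → H ∈ C l m → H.comp K ∈ C k m
  invol_mem : ∀ {k l : ℕ} (K : BilabelledGraph.{u} k l), K ∈ C k l → K.invol ∈ C l k

/-- Graph categories. Bilabelled graphs are considered up to isomorphism. -/
structure IsGraphCategory (C : GraphFamily.{u}) : Prop where
  iso_mem : ∀ {k l : ℕ} (K H : BilabelledGraph.{u} k l), K.Iso H → K ∈ C k l → H ∈ C k l
  null_mem : BilabelledGraph.null ∈ C 0 0
  identity_mem : BilabelledGraph.single 1 1 ∈ C 1 1
  pair_mem : BilabelledGraph.single 0 2 ∈ C 0 2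
  tensor_mem : ∀ {k l k' l' : ℕ} (K : BilabelledGraph.{u} k l) (H : BilabelledGraph.{u} k' l'),
    K ∈ C k l → H ∈ C k' l' → K.tensor H ∈ C (k + k') (l + l')
  comp_mem : ∀ {k l m : ℕ} (K : BilabelledGraph.{u} k l) (H : BilabelledGraph.{u} l m),
    K ∈ C k l → H ∈ C l m → H.comp K ∈ C k m
  invol_mem : ∀ {k l : ℕ} (K : BilabelledGraph.{u} k l), K ∈ C k l → K.invol ∈ C l k

/-- Group-theoretical graph categories: graph categories closed under graph quotients. -/
structure IsGroupTheoretical (C : GraphFamily.{u}) : Prop extends IsGraphCategory C where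
  quot_mem : ∀ {k l : ℕ} (K : BilabelledGraph.{u} k l) (π : Setoid K.V),
    K ∈ C k l → K.quot π ∈ C k l

/-- The space of linear maps from the `k`-th to the `l`-th tensor power of `ℂ^V`, written as
matrices in the standard bases, which are indexed by multiindices. -/
abbrev TensorMap (V : Type u) (k l : ℕ) : Type u := Matrix (Fin l → V) (Fin k → V) ℂ

/-- The linear map given by `K`: its entry at `(j, i)` is the number of injective homomorphisms
`φ : K → G` with `φ(a) = i` and `φ(b) = j`. -/
noncomputable def hatT {V : Type u} (G : LoopGraph V) {k l : ℕ} (K : BilabelledGraph.{u} k l) :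
    TensorMap V k l :=
  Matrix.of fun j i => (Nat.card {φ : K.V → V // K.graph.IsHom G φ ∧ Function.Injective φ ∧
    (∀ s, φ (K.inp s) = i s) ∧ ∀ t, φ (K.out t) = j t} : ℂ)

/-- The linear span of the maps given by the bilabelled graphs in `C k l`. -/
noncomputable def GraphFamily.spanAt {V : Type u} (C : GraphFamily.{u}) (G : LoopGraph V)
    (k l : ℕ) : Submodule ℂ (TensorMap V k l) :=
  Submodule.span ℂ (hatT G '' C k l)

/-! ## Free products of copies of the group of order two -/

/-- The free product of copies of `ℤ/2`, indexed by `V`. -/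
abbrev FreeZ2 (V : Type u) : Type u := Monoid.CoprodI fun _ : V => Multiplicative (ZMod 2)

namespace FreeZ2

variable {V W : Type u}

/-- The generator of the copy of `ℤ/2` with index `v`. -/
def gen (v : V) : FreeZ2 V :=
  Monoid.CoprodI.of (M := fun _ : V => Multiplicative (ZMod 2)) (i := v) (Multiplicative.ofAdd 1)

/-- The homomorphism of free products that is induced by a map of the index sets. -/
def map (φ : V → W) : FreeZ2 V →* FreeZ2 W :=
  Monoid.CoprodI.lift fun v =>
    Monoid.CoprodI.of (M := fun _ : W => Multiplicative (ZMod 2)) (i := φ v)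

lemma map_gen (φ : V → W) (v : V) : map φ (gen v) = gen (φ v) := by
  simp [map, gen]

lemma gen_mul_self (v : V) : gen v * gen v = 1 := by
  have h : (Multiplicative.ofAdd (1 : ZMod 2)) * Multiplicative.ofAdd 1 = 1 := by decide
  rw [gen, ← map_mul, h, map_one]

lemma closure_gen : Subgroup.closure (Set.range (gen : V → FreeZ2 V)) = ⊤ := by
  rw [eq_top_iff]
  intro x _
  induction x using Monoid.CoprodI.induction_on with
  | one => exact one_mem _
  | of i m =>
    have h : m = 1 ∨ m = Multiplicative.ofAdd 1 := by
      have hz : ∀ z : Multiplicative (ZMod 2), z = 1 ∨ z = Multiplicative.ofAdd 1 := by decide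
      exact hz m
    rcases h with rfl | rfl
    · rw [map_one]; exact one_mem _
    · exact Subgroup.subset_closure ⟨i, rfl⟩
  | mul x y hx hy => exact mul_mem (hx trivial) (hy trivial)

/-- `A` is mapped into itself by all automorphisms of `G`. -/
def AutInvariant (G : LoopGraph V) (A : Subgroup (FreeZ2 V)) : Prop :=
  ∀ σ ∈ G.Aut, A.map (map σ) ≤ A

/-- `A` is mapped into itself by all endomorphisms of `G`. -/
def EndInvariant (G : LoopGraph V) (A : Subgroup (FreeZ2 V)) : Prop :=
  ∀ φ : V → V, G.IsHom G φ → A.map (map φ) ≤ A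

lemma EndInvariant.autInvariant {G : LoopGraph V} {A : Subgroup (FreeZ2 V)}
    (h : EndInvariant G A) : AutInvariant G A :=
  fun σ hσ => h σ fun v w hvw => (hσ v w).mp hvw

end FreeZ2

/-! ## Compact matrix quantum groups -/

/-- Orthogonal compact matrix quantum groups, whose fundamental representation is indexed by
`V`, in terms of their coordinate *-algebras. The comultiplication takes values in the algebraic tensor
product, as it does on the generators. -/
structure OrthogonalCMQG (V : Type u) [Fintype V] [DecidableEq V] where
  O : Type u
  [ring : Ring O]
  [starRing : StarRing O]
  [algebra : Algebra ℂ O]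
  [starModule : StarModule ℂ O]
  /-- the fundamental representation -/
  rep : Matrix V V O
  generates : StarAlgebra.adjoin ℂ (Set.range fun p : V × V => rep p.1 p.2) = ⊤
  star_rep : ∀ i j, star (rep i j) = rep i j
  rep_mul_transpose : rep * rep.transpose = 1
  transpose_mul_rep : rep.transpose * rep = 1
  comul : ∃ Δ : O →⋆ₐ[ℂ] O ⊗[ℂ] O, ∀ i j, Δ (rep i j) = ∑ k, rep i k ⊗ₜ[ℂ] rep k j

attribute [instance] OrthogonalCMQG.ring OrthogonalCMQG.starRing OrthogonalCMQG.algebra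
  OrthogonalCMQG.starModule

/-- The `k`-th tensor power of a matrix: its entry at `(i, j)` is `w i₁ j₁ * ... * w iₖ jₖ`. -/
def tensorPow {V : Type u} {O : Type u} [Ring O] (w : Matrix V V O) (k : ℕ) :
    Matrix (Fin k → V) (Fin k → V) O :=
  Matrix.of fun i j => (List.ofFn fun s => w (i s) (j s)).prod

/-- The space of intertwiners between the `k`-th and the `l`-th tensor power of the fundamental
representation `w`, that is, of all `T` such that `T w^{⊗k} = w^{⊗l} T`. -/
def OrthogonalCMQG.Mor {V : Type u} [Fintype V] [DecidableEq V] (Q : OrthogonalCMQG V)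
    (k l : ℕ) : Submodule ℂ (TensorMap V k l) where
  carrier := {T | T.map (algebraMap ℂ Q.O) * tensorPow Q.rep k =
    tensorPow Q.rep l * T.map (algebraMap ℂ Q.O)}
  zero_mem' := by simp
  add_mem' := by
    intro S T hS hT
    simp only [Set.mem_ofPred_eq] at *
    rw [Matrix.map_add _ (map_add _), Matrix.add_mul, Matrix.mul_add, hS, hT]
  smul_mem' := by
    intro c T hT
    simp only [Set.mem_ofPred_eq] at *
    have h : (c • T).map (algebraMap ℂ Q.O) = c • T.map (algebraMap ℂ Q.O) := by
      ext i j
      simp [Algebra.smul_def]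
    rw [h, Matrix.smul_mul, Matrix.mul_smul, hT]

/-! ## The semidirect product of a group dual with a permutation group -/

namespace GroupAlgebra

variable {Γ : Type u} [Group Γ]

/-- The involution of the group algebra, which is conjugate linear and sends `g` to `g⁻¹`. -/
noncomputable def starHom (Γ : Type u) [Group Γ] : MonoidAlgebra ℂ Γ →+ MonoidAlgebra ℂ Γ :=
  MonoidAlgebra.liftNC
    ((MonoidAlgebra.singleAddHom (1 : Γ)).comp (starAddEquiv (R := ℂ)).toAddMonoidHom)
    fun g => MonoidAlgebra.single g⁻¹ 1

lemma starHom_single (g : Γ) (c : ℂ) :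
    starHom Γ (MonoidAlgebra.single g c) = MonoidAlgebra.single g⁻¹ (star c) := by
  simp [starHom, MonoidAlgebra.liftNC_single, MonoidAlgebra.single_mul_single]

noncomputable instance : StarRing (MonoidAlgebra ℂ Γ) where
  star := starHom Γ
  star_involutive := by
    intro x
    induction x using MonoidAlgebra.induction_linear with
    | zero => simp
    | add x y hx hy => rw [map_add, map_add, hx, hy]
    | single g c => simp [starHom_single]
  star_mul := by
    intro x y
    change starHom Γ (x * y) = starHom Γ y * starHom Γ x
    induction x using MonoidAlgebra.induction_linear with
    | zero => simp
    | add x x' hx hx' => rw [add_mul, map_add, hx, hx', map_add, mul_add]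
    | single g c =>
      induction y using MonoidAlgebra.induction_linear with
      | zero => simp
      | add y y' hy hy' => rw [mul_add, map_add, hy, hy', map_add, add_mul]
      | single h d =>
        simp [starHom_single, MonoidAlgebra.single_mul_single, mul_comm]
  star_add := map_add (starHom Γ)

lemma star_single (g : Γ) (c : ℂ) :
    star (MonoidAlgebra.single g c) = MonoidAlgebra.single g⁻¹ (star c) :=
  starHom_single g c

instance : StarModule ℂ (MonoidAlgebra ℂ Γ) where
  star_smul := by
    intro r x
    induction x using MonoidAlgebra.induction_linear with
    | zero => simp
    | add x y hx hy => rw [smul_add, star_add, hx, hy, star_add, smul_add]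
    | single g c => simp [star_single, MonoidAlgebra.smul_single]

end GroupAlgebra

namespace Semidirect

variable {V : Type u} [DecidableEq V] {Γ : Type u}

/-- The coordinate function `σ ↦ δ_{i, σ(j)}` of a group of permutation matrices. -/
def coord (H : Subgroup (Equiv.Perm V)) (i j : V) : H → ℂ :=
  fun σ => if (σ : Equiv.Perm V) j = i then 1 else 0

/-- The fundamental representation, with entries `u_{ij} = γ_i v_{ij}` in `ℂΓ ⊗ O(H)`; since `H`
is finite, its coordinate functions generate the algebra of all functions on `H`. -/
noncomputable def rep (H : Subgroup (Equiv.Perm V)) (s : V → Γ) :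
    Matrix V V (MonoidAlgebra ℂ Γ ⊗[ℂ] (H → ℂ)) :=
  Matrix.of fun i j => MonoidAlgebra.single (s i) 1 ⊗ₜ[ℂ] coord H i j

variable {H : Subgroup (Equiv.Perm V)} {s : V → Γ}

lemma rep_apply (i j : V) :
    rep H s i j = MonoidAlgebra.single (s i) 1 ⊗ₜ[ℂ] coord H i j := rfl

variable [Group Γ]

lemma star_rep (hs : ∀ i, s i * s i = 1) (i j : V) : star (rep H s i j) = rep H s i j := by
  have h : (s i)⁻¹ = s i := inv_eq_of_mul_eq_one_left (hs i)
  have h' : star (coord H i j) = coord H i j := by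
    funext σ
    simp only [coord, Pi.star_apply]
    split_ifs <;> simp
  rw [rep_apply, TensorProduct.star_tmul, GroupAlgebra.star_single, h, h', star_one]

lemma coord_mul_self (i j : V) : coord H i j * coord H i j = coord H i j := by
  funext σ
  simp [coord]

variable [Fintype V]

lemma rep_mul_transpose (hs : ∀ i, s i * s i = 1) : rep H s * (rep H s).transpose = 1 := by
  ext i j
  have h : ∑ k, coord H i k * coord H j k = if i = j then 1 else 0 := by
    funext σ
    simp only [coord, Finset.sum_apply, Pi.mul_apply, mul_ite, mul_one, mul_zero]
    rw [Finset.sum_eq_single ((σ : Equiv.Perm V).symm j)]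
    · by_cases hij : i = j
      · simp [hij]
      · simp [hij, Ne.symm hij]
    · intro b _ hb
      have : (σ : Equiv.Perm V) b ≠ j := fun h => hb (by rw [← h]; simp)
      simp [this]
    · simp
  simp only [Matrix.mul_apply, Matrix.transpose_apply, rep_apply,
    Algebra.TensorProduct.tmul_mul_tmul, MonoidAlgebra.single_mul_single, mul_one]
  rw [← TensorProduct.tmul_sum, h]
  by_cases hij : i = j
  · subst hij
    simp [hs, Algebra.TensorProduct.one_def, MonoidAlgebra.one_def]
  · simp [hij]

lemma transpose_mul_rep (hs : ∀ i, s i * s i = 1) : (rep H s).transpose * rep H s = 1 := by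
  ext i j
  have h : ∑ k, coord H k i * coord H k j = if i = j then 1 else 0 := by
    funext σ
    simp only [coord, Finset.sum_apply, Pi.mul_apply, mul_ite, mul_one, mul_zero]
    rw [Finset.sum_eq_single ((σ : Equiv.Perm V) j)]
    · by_cases hij : i = j
      · simp [hij]
      · simp [hij]
    · intro b _ hb
      simp [Ne.symm hb]
    · simp
  simp only [Matrix.mul_apply, Matrix.transpose_apply, rep_apply,
    Algebra.TensorProduct.tmul_mul_tmul, MonoidAlgebra.single_mul_single, mul_one, hs]
  rw [← TensorProduct.tmul_sum, h]
  by_cases hij : i = j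
  · subst hij
    simp [Algebra.TensorProduct.one_def, MonoidAlgebra.one_def]
  · simp [hij]

lemma sum_coord (i : V) : ∑ k, coord H i k = 1 := by
  funext σ
  simp only [coord, Finset.sum_apply, Pi.one_apply]
  rw [Finset.sum_eq_single ((σ : Equiv.Perm V).symm i)]
  · simp
  · intro b _ hb
    have : (σ : Equiv.Perm V) b ≠ i := fun h => hb (by rw [← h]; simp)
    simp [this]
  · simp

lemma prod_coord (σ : H) : ∏ j, coord H ((σ : Equiv.Perm V) j) j = Pi.single σ 1 := by
  funext τ
  simp only [Finset.prod_apply, coord]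
  by_cases h : τ = σ
  · subst h; simp
  · rw [Pi.single_eq_of_ne h]
    have : ∃ j, (τ : Equiv.Perm V) j ≠ (σ : Equiv.Perm V) j := by
      by_contra hc
      push Not at hc
      exact h (Subtype.ext (Equiv.ext hc))
    obtain ⟨j, hj⟩ := this
    exact Finset.prod_eq_zero (Finset.mem_univ j) (by simp [hj])

lemma generates (hs : ∀ i, s i * s i = 1) (hgen : Subgroup.closure (Set.range s) = ⊤) :
    StarAlgebra.adjoin ℂ (Set.range fun p : V × V => rep H s p.1 p.2) = ⊤ := by
  classical
  set S := StarAlgebra.adjoin ℂ (Set.range fun p : V × V => rep H s p.1 p.2) with hS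
  have hrep : ∀ i j, rep H s i j ∈ S := fun i j =>
    StarAlgebra.subset_adjoin ℂ _ ⟨(i, j), rfl⟩
  have hcoord : ∀ i j, (1 : MonoidAlgebra ℂ Γ) ⊗ₜ[ℂ] coord H i j ∈ S := by
    intro i j
    have h := mul_mem (hrep i j) (hrep i j)
    rwa [rep_apply, Algebra.TensorProduct.tmul_mul_tmul, MonoidAlgebra.single_mul_single, hs,
      mul_one, coord_mul_self, ← MonoidAlgebra.one_def] at h
  have hfun : ∀ f : H → ℂ, (1 : MonoidAlgebra ℂ Γ) ⊗ₜ[ℂ] f ∈ S := by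
    intro f
    let ι : (H → ℂ) →ₐ[ℂ] MonoidAlgebra ℂ Γ ⊗[ℂ] (H → ℂ) := Algebra.TensorProduct.includeRight
    have hsingle : ∀ σ : H, (Pi.single σ 1 : H → ℂ) ∈ S.toSubalgebra.comap ι := by
      intro σ
      rw [← prod_coord σ]
      exact Subalgebra.prod_mem _ fun j _ => hcoord _ _
    have hf : f = ∑ σ : H, f σ • (Pi.single σ 1 : H → ℂ) := by
      funext τ
      simp [Finset.sum_apply, Pi.single_apply]
    have : f ∈ S.toSubalgebra.comap ι := by
      rw [hf]
      exact Subalgebra.sum_mem _ fun σ _ => Subalgebra.smul_mem _ (hsingle σ) _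
    exact this
  have hgamma : ∀ i, (MonoidAlgebra.single (s i) (1 : ℂ)) ⊗ₜ[ℂ] (1 : H → ℂ) ∈ S := by
    intro i
    rw [← sum_coord i, TensorProduct.tmul_sum]
    exact sum_mem fun k _ => hrep i k
  have hgroup : ∀ g : Γ, (MonoidAlgebra.single g (1 : ℂ)) ⊗ₜ[ℂ] (1 : H → ℂ) ∈ S := by
    intro g
    have hg : g ∈ Subgroup.closure (Set.range s) := hgen ▸ Subgroup.mem_top g
    induction hg using Subgroup.closure_induction with
    | mem x hx => obtain ⟨i, rfl⟩ := hx; exact hgamma i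
    | one => rw [← MonoidAlgebra.one_def, ← Algebra.TensorProduct.one_def]; exact one_mem S
    | mul x y _ _ hx hy =>
      have h := mul_mem hx hy
      rwa [Algebra.TensorProduct.tmul_mul_tmul, MonoidAlgebra.single_mul_single, mul_one,
        mul_one] at h
    | inv x _ hx =>
      have h := star_mem hx
      rwa [TensorProduct.star_tmul, GroupAlgebra.star_single, star_one, star_one] at h
  rw [eq_top_iff]
  intro x _
  induction x with
  | zero => exact zero_mem S
  | add x y hx hy => exact add_mem (hx trivial) (hy trivial)
  | tmul a f =>
    induction a using MonoidAlgebra.induction_linear with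
    | zero => rw [TensorProduct.zero_tmul]; exact zero_mem S
    | add a b ha hb => rw [TensorProduct.add_tmul]; exact add_mem (ha trivial) (hb trivial)
    | single g c =>
      have h := SMulMemClass.smul_mem c (mul_mem (hgroup g) (hfun f))
      rwa [Algebra.TensorProduct.tmul_mul_tmul, mul_one, one_mul, TensorProduct.smul_tmul',
        MonoidAlgebra.smul_single, smul_eq_mul, mul_one] at h

/-- A sum of *-homomorphisms, cut down by orthogonal central projections with sum `1`. -/
lemma exists_starAlgHom_of_projections {A B ι : Type u} [Ring A] [StarRing A] [Algebra ℂ A]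
    [Ring B] [StarRing B] [Algebra ℂ B] [StarModule ℂ B] [Fintype ι] [DecidableEq ι]
    (P : ι → B) (hP : ∀ p q, P p * P q = if p = q then P p else 0) (hsum : ∑ p, P p = 1)
    (hcen : ∀ p y, P p * y = y * P p) (hstar : ∀ p, star (P p) = P p) (Ψ : ι → A →ₐ[ℂ] B)
    (hΨ : ∀ p x, Ψ p (star x) = star (Ψ p x)) :
    ∃ Δ : A →⋆ₐ[ℂ] B, ∀ x, Δ x = ∑ p, P p * Ψ p x := by
  refine ⟨{ toFun := fun x => ∑ p, P p * Ψ p x, map_one' := ?_, map_mul' := ?_, map_zero' := ?_,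
            map_add' := ?_, commutes' := ?_, map_star' := ?_ }, fun x => rfl⟩
  · simp [hsum]
  · intro x y
    rw [Finset.sum_mul_sum]
    refine Finset.sum_congr rfl fun p _ => ?_
    have h : ∀ q, P p * Ψ p x * (P q * Ψ q y) = if p = q then P p * (Ψ p x * Ψ q y) else 0 := by
      intro q
      rw [mul_assoc, ← mul_assoc (Ψ p x), ← hcen q, mul_assoc, ← mul_assoc (P p), hP]
      split_ifs <;> simp
    simp [h]
  · simp
  · intro x y
    simp [mul_add, Finset.sum_add_distrib]
  · intro c
    simp only [AlgHom.commutes]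
    rw [← Finset.sum_mul, hsum, one_mul]
  · intro x
    simp only [star_sum, star_mul, hΨ, hstar, hcen]

lemma tmul_central {A B : Type u} [Ring A] [Algebra ℂ A] [Ring B] [Algebra ℂ B] {a : A} {b : B}
    (ha : ∀ x, a * x = x * a) (hb : ∀ y, b * y = y * b) (z : A ⊗[ℂ] B) :
    (a ⊗ₜ[ℂ] b) * z = z * (a ⊗ₜ[ℂ] b) := by
  induction z with
  | zero => simp
  | add x y hx hy => rw [mul_add, hx, hy, add_mul]
  | tmul x y => rw [Algebra.TensorProduct.tmul_mul_tmul, Algebra.TensorProduct.tmul_mul_tmul,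
      ha, hb]

lemma exists_algHom {B : Type u} [Ring B] [StarRing B] [Algebra ℂ B] [StarModule ℂ B]
    (F : Γ →* B) (hF : ∀ g, F g⁻¹ = star (F g)) (σ : H) :
    ∃ Ψ : (MonoidAlgebra ℂ Γ ⊗[ℂ] (H → ℂ)) →ₐ[ℂ] B,
      (∀ g c f, Ψ (MonoidAlgebra.single g c ⊗ₜ f) = (c * f σ) • F g) ∧
        ∀ x, Ψ (star x) = star (Ψ x) := by
  have hcomm : ∀ (x : MonoidAlgebra ℂ Γ) (f : H → ℂ), Commute (MonoidAlgebra.lift ℂ B Γ F x)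
      (((Algebra.ofId ℂ B).comp (Pi.evalAlgHom ℂ (fun _ : H => ℂ) σ)) f) := fun x f =>
    Algebra.commute_algebraMap_right (f σ) (MonoidAlgebra.lift ℂ B Γ F x)
  let Ψ : (MonoidAlgebra ℂ Γ ⊗[ℂ] (H → ℂ)) →ₐ[ℂ] B := Algebra.TensorProduct.lift _ _ hcomm
  have hΨ : ∀ g c f, Ψ (MonoidAlgebra.single g c ⊗ₜ f) = (c * f σ) • F g := by
    intro g c f
    have h : Ψ (MonoidAlgebra.single g c ⊗ₜ f) =
        MonoidAlgebra.lift ℂ B Γ F (MonoidAlgebra.single g c) * algebraMap ℂ B (f σ) :=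
      Algebra.TensorProduct.lift_tmul _ _ hcomm _ _
    rw [h, MonoidAlgebra.lift_single, ← Algebra.commutes, ← Algebra.smul_def, smul_smul, mul_comm]
  refine ⟨Ψ, hΨ, fun x => ?_⟩
  induction x with
  | zero => simp
  | add x y hx hy => rw [star_add, map_add, hx, hy, map_add, star_add]
  | tmul a f =>
    induction a using MonoidAlgebra.induction_linear with
    | zero => simp
    | add a b ha hb =>
      rw [TensorProduct.add_tmul, star_add, map_add, ha, hb, map_add, star_add]
    | single g c =>
      rw [TensorProduct.star_tmul, GroupAlgebra.star_single, hΨ, hΨ, hF, star_smul, star_mul']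
      rfl

lemma exists_comul (hact : ∀ σ : H, ∃ φ : Γ →* Γ, ∀ i, φ (s i) = s ((σ : Equiv.Perm V) i)) :
    ∃ Δ : (MonoidAlgebra ℂ Γ ⊗[ℂ] (H → ℂ)) →⋆ₐ[ℂ]
      (MonoidAlgebra ℂ Γ ⊗[ℂ] (H → ℂ)) ⊗[ℂ] (MonoidAlgebra ℂ Γ ⊗[ℂ] (H → ℂ)),
      ∀ i j, Δ (rep H s i j) = ∑ k, rep H s i k ⊗ₜ[ℂ] rep H s k j := by
  classical
  choose φ hφ using hact
  let e : H → H → ℂ := fun σ => Pi.single σ 1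
  have he : ∀ σ τ, e σ * e τ = if σ = τ then e σ else 0 := by
    intro σ τ
    funext ρ
    by_cases h : σ = τ
    · subst h
      simp only [e, Pi.mul_apply, Pi.single_apply, if_true]
      split_ifs <;> simp
    · simp only [e, Pi.mul_apply, Pi.single_apply, if_neg h]
      by_cases h1 : ρ = σ
      · subst h1; simp [h]
      · simp [h1]
  have hesum : ∑ σ, e σ = 1 := by
    funext ρ
    simp [e, Finset.sum_apply, Pi.single_apply]
  have hestar : ∀ σ, star (e σ) = e σ := by
    intro σ
    funext ρ
    simp only [e, Pi.star_apply, Pi.single_apply]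
    split_ifs <;> simp
  have hecoord : ∀ (i j : V) (σ : H),
      coord H i j * e σ = (if (σ : Equiv.Perm V) j = i then (1 : ℂ) else 0) • e σ := by
    intro i j σ
    funext ρ
    by_cases h : ρ = σ
    · subst h; simp [e, coord]
    · simp [e, h]
  let P : H × H → (MonoidAlgebra ℂ Γ ⊗[ℂ] (H → ℂ)) ⊗[ℂ] (MonoidAlgebra ℂ Γ ⊗[ℂ] (H → ℂ)) :=
    fun p => (1 ⊗ₜ e p.1) ⊗ₜ (1 ⊗ₜ e p.2)
  let F : H × H → Γ →*
      (MonoidAlgebra ℂ Γ ⊗[ℂ] (H → ℂ)) ⊗[ℂ] (MonoidAlgebra ℂ Γ ⊗[ℂ] (H → ℂ)) := fun p =>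
    { toFun := fun g =>
        (MonoidAlgebra.single g 1 ⊗ₜ 1) ⊗ₜ (MonoidAlgebra.single (φ p.1⁻¹ g) 1 ⊗ₜ 1)
      map_one' := by
        rw [map_one, ← MonoidAlgebra.one_def]
        rfl
      map_mul' := fun g h => by
        simp [Algebra.TensorProduct.tmul_mul_tmul, MonoidAlgebra.single_mul_single] }
  have hF : ∀ p g, F p g =
      (MonoidAlgebra.single g 1 ⊗ₜ 1) ⊗ₜ (MonoidAlgebra.single (φ p.1⁻¹ g) 1 ⊗ₜ 1) :=
    fun _ _ => rfl
  have hFstar : ∀ p g, F p g⁻¹ = star (F p g) := by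
    intro p g
    rw [hF, hF, TensorProduct.star_tmul, TensorProduct.star_tmul, TensorProduct.star_tmul,
      GroupAlgebra.star_single, GroupAlgebra.star_single, map_inv, star_one, star_one]
  choose Ψ hΨ hPsi using fun p : H × H => exists_algHom (Γ := Γ) (H := H)
    (B := (MonoidAlgebra ℂ Γ ⊗[ℂ] (H → ℂ)) ⊗[ℂ] (MonoidAlgebra ℂ Γ ⊗[ℂ] (H → ℂ))) (F p) (hFstar p) (p.1 * p.2)
  have hP : ∀ p q, P p * P q = if p = q then P p else 0 := by
    rintro ⟨σ, τ⟩ ⟨σ', τ'⟩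
    simp only [P, Algebra.TensorProduct.tmul_mul_tmul, he, mul_one, Prod.mk.injEq]
    by_cases h1 : σ = σ' <;> by_cases h2 : τ = τ' <;> simp [h1, h2]
  have hPsum : ∑ p, P p = 1 := by
    rw [Fintype.sum_prod_type]
    simp only [P]
    simp only [← TensorProduct.tmul_sum, ← TensorProduct.sum_tmul, hesum]
    rfl
  have hPcen : ∀ p y, P p * y = y * P p := by
    intro p y
    have h : ∀ σ x, ((1 : MonoidAlgebra ℂ Γ) ⊗ₜ[ℂ] e σ) * x = x * (1 ⊗ₜ e σ) := fun σ =>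
      tmul_central (fun x => by rw [one_mul, mul_one]) (fun y => mul_comm _ _)
    exact tmul_central (h p.1) (h p.2) y
  have hPstar : ∀ p, star (P p) = P p := by
    intro p
    simp [P, TensorProduct.star_tmul, hestar]
  obtain ⟨Δ, hΔ⟩ := exists_starAlgHom_of_projections P hP hPsum hPcen hPstar Ψ hPsi
  refine ⟨Δ, fun i j => ?_⟩
  have hcoordsum : ∀ i j, coord H i j =
      ∑ σ : H, (if (σ : Equiv.Perm V) j = i then (1 : ℂ) else 0) • e σ := by
    intro i j
    rw [← mul_one (coord H i j), ← hesum, Finset.mul_sum]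
    exact Finset.sum_congr rfl fun σ _ => hecoord i j σ
  have hterm : ∀ (k : V) (σ τ : H),
      (MonoidAlgebra.single (s i) (1 : ℂ) ⊗ₜ[ℂ]
          ((if (σ : Equiv.Perm V) k = i then (1 : ℂ) else 0) • e σ)) ⊗ₜ[ℂ]
        (MonoidAlgebra.single (s k) (1 : ℂ) ⊗ₜ[ℂ]
          ((if (τ : Equiv.Perm V) j = k then (1 : ℂ) else 0) • e τ)) =
      if (τ : Equiv.Perm V) j = k then
        P (σ, τ) * Ψ (σ, τ) (rep H s i j) else 0 := by
    intro k σ τ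
    by_cases hk : (τ : Equiv.Perm V) j = k
    · subst hk
      rw [rep_apply, hΨ, hF]
      by_cases hi : (σ : Equiv.Perm V) ((τ : Equiv.Perm V) j) = i
      · have hs' : φ σ⁻¹ (s i) = s ((τ : Equiv.Perm V) j) := by
          rw [hφ, ← hi]; simp
        simp [hi, coord, P, hs', Algebra.TensorProduct.tmul_mul_tmul]
      · have h0 : coord H i j (σ * τ) = 0 := by simp [coord, hi]
        rw [if_pos rfl, if_neg hi]
        dsimp only
        rw [h0]
        simp only [mul_zero, zero_smul, TensorProduct.tmul_zero, TensorProduct.zero_tmul]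
        rw [if_pos trivial]
        exact (mul_zero (P (σ, τ))).symm
    · simp [hk]
  have hk : ∀ k, rep H s i k ⊗ₜ[ℂ] rep H s k j = ∑ σ : H, ∑ τ : H,
      if (τ : Equiv.Perm V) j = k then P (σ, τ) * Ψ (σ, τ) (rep H s i j) else 0 := by
    intro k
    have h1 : rep H s i k = ∑ σ : H, MonoidAlgebra.single (s i) (1 : ℂ) ⊗ₜ[ℂ]
        ((if (σ : Equiv.Perm V) k = i then (1 : ℂ) else 0) • e σ) := by
      rw [rep_apply, hcoordsum, TensorProduct.tmul_sum]
    have h2 : rep H s k j = ∑ τ : H, MonoidAlgebra.single (s k) (1 : ℂ) ⊗ₜ[ℂ]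
        ((if (τ : Equiv.Perm V) j = k then (1 : ℂ) else 0) • e τ) := by
      rw [rep_apply, hcoordsum, TensorProduct.tmul_sum]
    rw [h1, h2, TensorProduct.sum_tmul]
    refine Finset.sum_congr rfl fun σ _ => ?_
    rw [TensorProduct.tmul_sum]
    exact Finset.sum_congr rfl fun τ _ => hterm k σ τ
  have hsum : ∑ k, rep H s i k ⊗ₜ[ℂ] rep H s k j = ∑ k : V, ∑ σ : H, ∑ τ : H,
      if (τ : Equiv.Perm V) j = k then P (σ, τ) * Ψ (σ, τ) (rep H s i j) else 0 :=
    Finset.sum_congr rfl fun k _ => hk k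
  rw [hΔ, Fintype.sum_prod_type, hsum]
  refine Eq.trans ?_ Finset.sum_comm
  refine Finset.sum_congr rfl fun σ _ => ?_
  refine Eq.trans ?_ Finset.sum_comm
  refine Finset.sum_congr rfl fun τ _ => ?_
  exact (Fintype.sum_ite_eq ((τ : Equiv.Perm V) j)
    fun _ => P (σ, τ) * Ψ (σ, τ) (rep H s i j)).symm

end Semidirect

/-- The semidirect product of the dual of a group `Γ` with generators `s i` of order at most two
by a group `H` of permutations of the generators that extend to endomorphisms of `Γ`. Its
coordinate algebra is `ℂΓ ⊗ O(H)`, and its fundamental representation is the product of the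
diagonal matrix of the `γ_i` with the fundamental representation of `H`. -/
noncomputable def dualSemidirect {V : Type u} [Fintype V] [DecidableEq V] {Γ : Type u} [Group Γ]
    (s : V → Γ) (H : Subgroup (Equiv.Perm V)) (hs : ∀ i, s i * s i = 1)
    (hgen : Subgroup.closure (Set.range s) = ⊤)
    (hact : ∀ σ : H, ∃ φ : Γ →* Γ, ∀ i, φ (s i) = s ((σ : Equiv.Perm V) i)) :
    OrthogonalCMQG V where
  O := MonoidAlgebra ℂ Γ ⊗[ℂ] (H → ℂ)
  rep := Semidirect.rep H s
  generates := Semidirect.generates hs hgen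
  star_rep := Semidirect.star_rep hs
  rep_mul_transpose := Semidirect.rep_mul_transpose hs
  transpose_mul_rep := Semidirect.transpose_mul_rep hs
  comul := Semidirect.exists_comul hact

namespace FreeZ2

variable {V : Type u}

/-- The image of a generator in the quotient by `A`. -/
def quotGen (A : Subgroup (FreeZ2 V)) [A.Normal] (v : V) : FreeZ2 V ⧸ A :=
  QuotientGroup.mk' A (gen v)

/-- The quantum group `Γ^ ⋊ Aut G`, where `Γ` is the quotient of the free product by `A`. -/
noncomputable def semidirectAut [Fintype V] [DecidableEq V] (G : LoopGraph V)
    (A : Subgroup (FreeZ2 V)) [A.Normal] (hA : AutInvariant G A) : OrthogonalCMQG V :=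
  dualSemidirect (quotGen A) G.Aut
    (fun i => by rw [quotGen, ← map_mul, gen_mul_self, map_one])
    (by
      have h : Set.range (quotGen A) = QuotientGroup.mk' A '' Set.range gen := by
        rw [← Set.range_comp]; rfl
      rw [h, ← MonoidHom.map_closure, closure_gen, ← MonoidHom.range_eq_map,
        QuotientGroup.range_mk'])
    (fun σ => ⟨QuotientGroup.map A A (map (σ : Equiv.Perm V))
      (Subgroup.map_le_iff_le_comap.mp (hA σ σ.2)), fun i => by
        change QuotientGroup.map A A _ _ (QuotientGroup.mk (gen i)) = _
        rw [QuotientGroup.map_mk, map_gen]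
        rfl⟩)

end FreeZ2

/-! Call the product in Γ of the generators along a tuple its value. The entry of `u^{⊗k}` at `(i,
j)` is the value of `i` tensored with the indicator of `σ ∘ j = i`. Hence `T` is an intertwiner
exactly when it is invariant under Aut G and its entry at `(j, i)` vanishes unless `i` and `j` have
equal values (`Semidirect.intertwines_iff_invariant`).

This dictates the category: take all `K` such that every injective homomorphism `K → G` sends inputs
and outputs to tuples with equal values (`injectiveBalanced`). Gluing along a partial injection
embeds both pieces, so injective homomorphisms restrict to injective ones and the required closure
properties follow. With all homomorphisms instead (`homBalanced`), arbitrary gluings and quotients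
are allowed as well.

The maps of either family satisfy both conditions on `T`. Conversely, let `G` itself be labelled by
`i` and `j`. Injective endomorphisms of a finite graph are automorphisms, so the map of this
labelled graph counts the `σ` in Aut G that carry `(j, i)` to a given pair. Every invariant `T` is
therefore a combination of such maps, with only labellings from its support
(`card_smul_eq_sum_hatT`, `spanAt_eq_mor`). These labellings lie in the first family by
Aut-invariance of `A`, and in the second by End-invariance. -/

/-! ### Homomorphisms and automorphisms of graphs. -/

namespace LoopGraph

variable {U V W : Type u}

lemma IsHom.comp {K : LoopGraph U} {H : LoopGraph V} {G : LoopGraph W} {ψ : V → W} {φ : U → V}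
    (hψ : H.IsHom G ψ) (hφ : K.IsHom H φ) : K.IsHom G (ψ ∘ φ) :=
  fun v w h => hψ _ _ (hφ v w h)

lemma isHom_quot_mk (K : LoopGraph V) (π : Setoid V) :
    K.IsHom (K.quot π) (Quotient.mk π) :=
  fun v w h => ⟨v, w, rfl, rfl, h⟩

lemma isHom_inl (K : LoopGraph V) (H : LoopGraph W) : K.IsHom (K.disjUnion H) Sum.inl :=
  fun _ _ h => Sum.LiftRel.inl h

lemma isHom_inr (K : LoopGraph V) (H : LoopGraph W) : H.IsHom (K.disjUnion H) Sum.inr :=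
  fun _ _ h => Sum.LiftRel.inr h

/-- A bijective endomorphism of a finite graph is an automorphism. -/
lemma mem_Aut_of_isHom [Finite V] {G : LoopGraph V} {σ : Equiv.Perm V} (h : G.IsHom G σ) :
    σ ∈ G.Aut := by
  have hpow : ∀ n : ℕ, G.IsHom G (σ ^ n : Equiv.Perm V) := by
    intro n
    induction n with
    | zero => exact fun v w h => h
    | succ n ih =>
      rw [pow_succ]
      exact ih.comp h
  obtain ⟨n, hn⟩ : σ⁻¹ ∈ Submonoid.powers σ :=
    mem_powers_iff_mem_zpowers.mpr (inv_mem (Subgroup.mem_zpowers σ))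
  refine fun v w => ⟨h v w, fun hvw => ?_⟩
  have := hpow n _ _ hvw
  change σ ^ n = σ⁻¹ at hn
  rw [hn] at this
  simpa using this

end LoopGraph

/-! ### Gluing along partial injections. -/

section Gluing

variable {V W : Type u} {f : V → W → Prop}

/-- Gluing along an injective partial function identifies no further vertices. -/
lemma glueSetoid_cases (hf : IsVertexOverlap f) {x y : V ⊕ W} (h : glueSetoid f x y) :
    x = y ∨ (∃ v w, x = Sum.inl v ∧ y = Sum.inr w ∧ f v w) ∨
      ∃ v w, y = Sum.inl v ∧ x = Sum.inr w ∧ f v w := by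
  have h' : Relation.EqvGen _ x y := h
  clear h
  induction h' with
  | rel x y h => exact Or.inr (Or.inl h)
  | refl x => exact Or.inl rfl
  | symm x y _ ih =>
    rcases ih with rfl | h | h
    · exact Or.inl rfl
    · exact Or.inr (Or.inr h)
    · exact Or.inr (Or.inl h)
  -- Two consecutive proper identifications change sides twice; uniqueness of partners brings them
  -- back to the starting vertex.
  | trans x y z _ _ ih₁ ih₂ =>
    rcases ih₁ with rfl | ⟨v, w, rfl, rfl, hvw⟩ | ⟨v, w, rfl, rfl, hvw⟩
    · exact ih₂
    · rcases ih₂ with rfl | ⟨v', w', h, -, -⟩ | ⟨v', w', rfl, h, hvw'⟩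
      · exact Or.inr (Or.inl ⟨v, w, rfl, rfl, hvw⟩)
      · cases h
      · cases h
        exact Or.inl (congrArg _ (hf.left_unique _ _ _ hvw hvw'))
    · rcases ih₂ with rfl | ⟨v', w', h, rfl, hvw'⟩ | ⟨v', w', -, h, -⟩
      · exact Or.inr (Or.inr ⟨v, w, rfl, rfl, hvw⟩)
      · cases h
        exact Or.inl (congrArg _ (hf.right_unique _ _ _ hvw hvw'))
      · cases h

/-- A proper identification joins opposite sides, so vertices on one side stay distinct. This lets
injectivity of a map on the glued graph pass to each piece. -/
lemma glueSetoid_inl_injective (hf : IsVertexOverlap f) :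
    Function.Injective fun v : V => Quotient.mk (glueSetoid f) (Sum.inl v) := by
  intro v v' h
  rcases glueSetoid_cases hf (Quotient.exact h) with h | ⟨_, _, -, h, -⟩ | ⟨_, _, -, h, -⟩ <;>
    cases h
  rfl

lemma glueSetoid_inr_injective (hf : IsVertexOverlap f) :
    Function.Injective fun w : W => Quotient.mk (glueSetoid f) (Sum.inr w) := by
  intro v v' h
  rcases glueSetoid_cases hf (Quotient.exact h) with h | ⟨_, _, h, -, -⟩ | ⟨_, _, h, -, -⟩ <;>
    cases h
  rfl

lemma glueSetoid_mk_eq {v : V} {w : W} (h : f v w) :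
    Quotient.mk (glueSetoid f) (Sum.inl v) = Quotient.mk (glueSetoid f) (Sum.inr w) :=
  Quotient.sound (Relation.EqvGen.rel _ _ ⟨v, w, rfl, rfl, h⟩)

/-- The kernel condition on compositions says precisely that `b i ↦ c i` is well defined and
injective; one implication gives each uniqueness. -/
lemma isVertexOverlap_of_ker_eq {l : ℕ} {b : Fin l → V} {c : Fin l → W}
    (h : Setoid.ker b = Setoid.ker c) : IsVertexOverlap fun v w => ∃ i, v = b i ∧ w = c i := by
  have h' : ∀ i j, b i = b j ↔ c i = c j := fun i j => Setoid.ext_iff.mp h i j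
  constructor
  · rintro _ _ _ ⟨i, rfl, rfl⟩ ⟨j, hij, rfl⟩
    exact (h' i j).mp hij
  · rintro _ _ _ ⟨i, rfl, rfl⟩ ⟨j, rfl, hij⟩
    exact (h' i j).mpr hij

end Gluing

/-! ### Values of words. -/

/-- The product of the elements `s (i₁), ..., s (iₖ)`. -/
def wordProd {V Γ : Type u} [Monoid Γ] (s : V → Γ) {k : ℕ} (i : Fin k → V) : Γ :=
  (List.ofFn fun t => s (i t)).prod

section WordProd

variable {V W Γ Δ : Type u} [Monoid Γ] [Monoid Δ] (s : V → Γ) {k l : ℕ}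

lemma wordProd_append (i : Fin k → V) (j : Fin l → V) :
    wordProd s (Fin.append i j) = wordProd s i * wordProd s j := by
  simp [wordProd, List.ofFn_add, List.prod_append]

lemma map_wordProd (φ : Γ →* Δ) (i : Fin k → V) : φ (wordProd s i) = wordProd (φ ∘ s) i := by
  simp [wordProd, map_list_prod, List.map_ofFn, Function.comp_def]

lemma comp_append (φ : V → W) (i : Fin k → V) (j : Fin l → V) :
    φ ∘ Fin.append i j = Fin.append (φ ∘ i) (φ ∘ j) := by
  funext t
  refine Fin.addCases (fun t => ?_) (fun t => ?_) t <;> simp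

end WordProd

/-! ### Balanced maps and the operations on bilabelled graphs. -/

namespace BilabelledGraph

variable {V Γ : Type u} [Group Γ] {k l m k' l' : ℕ}

/-- `φ` maps the inputs and the outputs of `K` to words with equal values. -/
def Balanced (s : V → Γ) (K : BilabelledGraph.{u} k l) (φ : K.V → V) : Prop :=
  wordProd s (φ ∘ K.inp) = wordProd s (φ ∘ K.out)

variable {s : V → Γ}

lemma balanced_of_iso {K H : BilabelledGraph.{u} k l} {e : K.V ≃ H.V}
    (hi : ∀ i, e (K.inp i) = H.inp i) (ho : ∀ j, e (K.out j) = H.out j) {φ : H.V → V}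
    (h : K.Balanced s (φ ∘ e)) : H.Balanced s φ := by
  have h1 : φ ∘ H.inp = (φ ∘ e) ∘ K.inp := by funext i; simp [hi]
  have h2 : φ ∘ H.out = (φ ∘ e) ∘ K.out := by funext i; simp [ho]
  rw [Balanced, h1, h2]
  exact h

lemma balanced_null (φ : (null.{u}).V → V) : null.Balanced s φ := rfl

lemma balanced_identity (φ : (single.{u} 1 1).V → V) : (single 1 1).Balanced s φ := rfl

/-- The empty word is compared with the square of a generator, so this is where the relation `γ² =
1` enters. -/
lemma balanced_pair (hs : ∀ i, s i * s i = 1) (φ : (single.{u} 0 2).V → V) :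
    (single 0 2).Balanced s φ := by
  have h : wordProd s (φ ∘ (single 0 2).out) = s (φ PUnit.unit) * s (φ PUnit.unit) := by
    simp only [wordProd, List.ofFn_succ, List.ofFn_zero, List.prod_cons, List.prod_nil, mul_one]
    rfl
  rw [Balanced, h, hs]
  rfl

lemma balanced_tensor {K : BilabelledGraph.{u} k l} {H : BilabelledGraph.{u} k' l'}
    {φ : (K.tensor H).V → V} (hK : K.Balanced s (φ ∘ Sum.inl)) (hH : H.Balanced s (φ ∘ Sum.inr)) :
    (K.tensor H).Balanced s φ := by
  have h1 : φ ∘ (K.tensor H).inp =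
      Fin.append ((φ ∘ Sum.inl) ∘ K.inp) ((φ ∘ Sum.inr) ∘ H.inp) :=
    comp_append (V := K.V ⊕ H.V) φ (fun t => Sum.inl (K.inp t)) fun t => Sum.inr (H.inp t)
  have h2 : φ ∘ (K.tensor H).out =
      Fin.append ((φ ∘ Sum.inl) ∘ K.out) ((φ ∘ Sum.inr) ∘ H.out) :=
    comp_append (V := K.V ⊕ H.V) φ (fun t => Sum.inl (K.out t)) fun t => Sum.inr (H.out t)
  rw [Balanced, h1, h2, wordProd_append, wordProd_append, hK, hH]

lemma balanced_comp {K : BilabelledGraph.{u} k l} {H : BilabelledGraph.{u} l m}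
    {φ : (H.comp K).V → V} (hK : K.Balanced s fun v => φ (Quotient.mk _ (Sum.inl v)))
    (hH : H.Balanced s fun v => φ (Quotient.mk _ (Sum.inr v))) :
    (H.comp K).Balanced s φ := by
  -- The outputs of `K` and the inputs of `H` are the same vertices after gluing, so the two balance
  -- equations chain.
  refine Eq.trans hK (Eq.trans ?_ hH)
  congr 1
  funext i
  exact congrArg φ (glueSetoid_mk_eq ⟨i, rfl, rfl⟩)

end BilabelledGraph

/-! ### The two graph categories. -/

/-- The bilabelled graphs all of whose injective homomorphisms to `G` are balanced. -/
def injectiveBalanced {V Γ : Type u} [Group Γ] (G : LoopGraph V) (s : V → Γ) : GraphFamily.{u} :=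
  fun _ _ => {K | ∀ φ : K.V → V, K.graph.IsHom G φ → Function.Injective φ → K.Balanced s φ}

/-- The bilabelled graphs all of whose homomorphisms to `G` are balanced. -/
def homBalanced {V Γ : Type u} [Group Γ] (G : LoopGraph V) (s : V → Γ) : GraphFamily.{u} :=
  fun _ _ => {K | ∀ φ : K.V → V, K.graph.IsHom G φ → K.Balanced s φ}

section Families

variable {V Γ : Type u} [Group Γ] (G : LoopGraph V) {s : V → Γ}

lemma homBalanced_subset_injectiveBalanced (k l : ℕ) :
    homBalanced G s k l ⊆ injectiveBalanced G s k l :=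
  fun _ hK φ hφ _ => hK φ hφ

/-- A homomorphism from a union or composition pulls back to both pieces; it stays injective because
the gluing is a partial injection. -/
lemma isSkewGraphCategory_injectiveBalanced (hs : ∀ i, s i * s i = 1) :
    IsSkewGraphCategory (injectiveBalanced G s) where
  iso_mem := by
    rintro k l K H ⟨e, he, hi, ho⟩ hK φ hφ hinj
    exact BilabelledGraph.balanced_of_iso hi ho
      (hK _ (hφ.comp fun v w h => (he v w).mp h) (hinj.comp e.injective))
  null_mem := fun φ _ _ => BilabelledGraph.balanced_null φ
  identity_mem := fun φ _ _ => BilabelledGraph.balanced_identity φ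
  pair_mem := fun φ _ _ => BilabelledGraph.balanced_pair hs φ
  union_mem := fun K H f hf hK hH φ hφ hinj => by
    have hq := hφ.comp (LoopGraph.isHom_quot_mk _ _)
    exact BilabelledGraph.balanced_tensor (φ := φ ∘ Quotient.mk (glueSetoid f))
      (hK _ (hq.comp (LoopGraph.isHom_inl _ _)) (hinj.comp (glueSetoid_inl_injective hf)))
      (hH _ (hq.comp (LoopGraph.isHom_inr _ _)) (hinj.comp (glueSetoid_inr_injective hf)))
  comp_mem := fun K H hker hK hH φ hφ hinj => by
    have hq := hφ.comp (LoopGraph.isHom_quot_mk _ _)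
    have hf := isVertexOverlap_of_ker_eq hker
    exact BilabelledGraph.balanced_comp
      (hK _ (hq.comp (LoopGraph.isHom_inl _ _)) (hinj.comp (glueSetoid_inl_injective hf)))
      (hH _ (hq.comp (LoopGraph.isHom_inr _ _)) (hinj.comp (glueSetoid_inr_injective hf)))
  invol_mem := fun _ hK φ hφ hinj => (hK φ hφ hinj).symm

/-- Balance is demanded of all homomorphisms, so any pullback along a quotient map may be used,
whatever vertices it identifies. -/
lemma isGroupTheoretical_homBalanced (hs : ∀ i, s i * s i = 1) :
    IsGroupTheoretical (homBalanced G s) where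
  iso_mem := by
    rintro k l K H ⟨e, he, hi, ho⟩ hK φ hφ
    exact BilabelledGraph.balanced_of_iso hi ho (hK _ (hφ.comp fun v w h => (he v w).mp h))
  null_mem := fun φ _ => BilabelledGraph.balanced_null φ
  identity_mem := fun φ _ => BilabelledGraph.balanced_identity φ
  pair_mem := fun φ _ => BilabelledGraph.balanced_pair hs φ
  tensor_mem := fun K H hK hH φ hφ =>
    BilabelledGraph.balanced_tensor (hK _ (hφ.comp (LoopGraph.isHom_inl _ _)))
      (hH _ (hφ.comp (LoopGraph.isHom_inr _ _)))
  comp_mem := fun K H hK hH φ hφ => by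
    have hq := hφ.comp (LoopGraph.isHom_quot_mk _ _)
    exact BilabelledGraph.balanced_comp (hK _ (hq.comp (LoopGraph.isHom_inl _ _)))
      (hH _ (hq.comp (LoopGraph.isHom_inr _ _)))
  invol_mem := fun _ hK φ hφ => (hK φ hφ).symm
  quot_mem := fun _ _ hK φ hφ => hK _ (hφ.comp (LoopGraph.isHom_quot_mk _ _))

end Families

/-- Group-theoretical graph categories are skew graph categories. -/
lemma IsGroupTheoretical.isSkewGraphCategory {C : GraphFamily.{u}} (hC : IsGroupTheoretical C) :
    IsSkewGraphCategory C where
  iso_mem := hC.iso_mem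
  null_mem := hC.null_mem
  identity_mem := hC.identity_mem
  pair_mem := hC.pair_mem
  -- A union is by definition a quotient of the tensor product.
  union_mem := fun K H _ _ hK hH => hC.quot_mem _ _ (hC.tensor_mem K H hK hH)
  comp_mem := fun K H _ hK hH => hC.comp_mem K H hK hH
  invol_mem := hC.invol_mem

/-! ### Intertwiners of the semidirect product. -/

namespace Semidirect

variable {V : Type u} [DecidableEq V] {Γ : Type u} [Group Γ]
  {H : Subgroup (Equiv.Perm V)} {s : V → Γ} {k l : ℕ}

lemma prod_ofFn_coord (i j : Fin k → V) (σ : H) :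
    (List.ofFn fun t => coord H (i t) (j t)).prod σ =
      if (σ : Equiv.Perm V) ∘ j = i then 1 else 0 := by
  rw [List.prod_ofFn, Finset.prod_apply]
  by_cases h : (σ : Equiv.Perm V) ∘ j = i
  · rw [if_pos h]
    exact Finset.prod_eq_one fun t _ => if_pos (congrFun h t)
  · rw [if_neg h]
    obtain ⟨t, ht⟩ := Function.ne_iff.mp h
    exact Finset.prod_eq_zero (Finset.mem_univ t) (if_neg ht)

/-- Multiplication in the tensor product is legwise, so group elements and coordinate functions
collect separately; the latter multiply to an indicator by `prod_ofFn_coord`. -/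
lemma tensorPow_rep (i j : Fin k → V) :
    tensorPow (rep H s) k i j =
      MonoidAlgebra.single (wordProd s i) (1 : ℂ) ⊗ₜ[ℂ]
        (List.ofFn fun t => coord H (i t) (j t)).prod := by
  induction k with
  | zero => simp [tensorPow, wordProd, Algebra.TensorProduct.one_def, MonoidAlgebra.one_def]
  | succ k ih =>
    have h := ih (fun t => i t.succ) (fun t => j t.succ)
    simp only [tensorPow, wordProd, Matrix.of_apply] at h ⊢
    rw [List.ofFn_succ, List.prod_cons, h, rep_apply, Algebra.TensorProduct.tmul_mul_tmul,
      MonoidAlgebra.single_mul_single, mul_one, List.ofFn_succ, List.prod_cons, List.ofFn_succ,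
      List.prod_cons]

/-- The intertwiner relation, entry by entry. -/
lemma intertwines_iff [Fintype V] (T : TensorMap V k l) :
    T.map (algebraMap ℂ (MonoidAlgebra ℂ Γ ⊗[ℂ] (H → ℂ))) * tensorPow (rep H s) k =
        tensorPow (rep H s) l * T.map (algebraMap ℂ (MonoidAlgebra ℂ Γ ⊗[ℂ] (H → ℂ))) ↔
      ∀ j i, ∑ m, T j m • (MonoidAlgebra.single (wordProd s m) (1 : ℂ) ⊗ₜ[ℂ]
          (List.ofFn fun t => coord H (m t) (i t)).prod) =
        ∑ m, T m i • (MonoidAlgebra.single (wordProd s j) (1 : ℂ) ⊗ₜ[ℂ]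
          (List.ofFn fun t => coord H (j t) (m t)).prod) := by
  rw [← Matrix.ext_iff]
  simp only [Matrix.mul_apply, Matrix.map_apply, ← Algebra.commutes (R := ℂ),
    ← Algebra.smul_def, tensorPow_rep]

omit [DecidableEq V] in
lemma comp_perm_eq_iff (σ : Equiv.Perm V) (i m : Fin k → V) :
    σ ∘ m = i ↔ m = σ.symm ∘ i := by
  constructor
  · rintro rfl; funext t; simp
  · rintro rfl; funext t; simp

/-- The intertwiners are the invariant matrices whose entries vanish outside of pairs of words
with equal values. -/
lemma intertwines_iff_invariant [Fintype V] (T : TensorMap V k l) :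
    T.map (algebraMap ℂ (MonoidAlgebra ℂ Γ ⊗[ℂ] (H → ℂ))) * tensorPow (rep H s) k =
        tensorPow (rep H s) l * T.map (algebraMap ℂ (MonoidAlgebra ℂ Γ ⊗[ℂ] (H → ℂ))) ↔
      (∀ j i, T j i ≠ 0 → wordProd s i = wordProd s j) ∧
        ∀ σ ∈ H, ∀ j i, T (σ ∘ j) (σ ∘ i) = T j i := by
  rw [intertwines_iff]
  constructor
  · intro h
    have hev : ∀ (σ : H) j i,
        T j ((σ : Equiv.Perm V) ∘ i) •
            MonoidAlgebra.single (wordProd s ((σ : Equiv.Perm V) ∘ i)) (1 : ℂ) =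
          T ((σ : Equiv.Perm V).symm ∘ j) i • MonoidAlgebra.single (wordProd s j) (1 : ℂ) := by
      intro σ j i
      -- Evaluating the function leg at `σ` leaves an identity in the group algebra; on each side
      -- the indicator selects a single `m`.
      obtain ⟨Ψ, hΨ, -⟩ := exists_algHom (B := MonoidAlgebra ℂ Γ) (H := H)
        (MonoidAlgebra.of ℂ Γ)
        (fun g => by simp [MonoidAlgebra.of_apply, GroupAlgebra.star_single]) σ
      have := congrArg Ψ (h j i)
      simpa only [map_sum, map_smul, hΨ, prod_ofFn_coord, comp_perm_eq_iff _ j, one_mul,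
        ite_smul, one_smul, zero_smul, smul_ite, smul_zero, Finset.sum_ite_eq,
        Finset.sum_ite_eq', Finset.mem_univ, if_true, MonoidAlgebra.of_apply] using this
    constructor
    · intro j i hT
      -- At `σ = 1` both sides carry the same coefficient `T j i`, so if it is nonzero the basis
      -- elements agree.
      have h1 := hev 1 j i
      simp only [MonoidAlgebra.smul_single, smul_eq_mul, mul_one] at h1
      have h2 : MonoidAlgebra.single (wordProd s i) (T j i) =
        MonoidAlgebra.single (wordProd s j) (T j i) := h1
      exact (MonoidAlgebra.single_left_inj hT).mp h2
    · intro σ hσ j i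
      -- The trivial character of Γ forgets the group elements and leaves the scalar identity.
      have h1 := congrArg (MonoidAlgebra.lift ℂ ℂ Γ 1) (hev ⟨σ, hσ⟩ (σ ∘ j) i)
      have h2 : σ.symm ∘ σ ∘ j = j := by funext t; simp
      simpa [h2] using h1
  · rintro ⟨hsupp, hinv⟩ j i
    -- On the support of `T` the value of `m` equals that of `j`, so the group leg factors out of
    -- the sum and only an identity of functions on `H` remains.
    have h1 : ∀ m, T j m • (MonoidAlgebra.single (wordProd s m) (1 : ℂ) ⊗ₜ[ℂ]
          (List.ofFn fun t => coord H (m t) (i t)).prod) =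
        MonoidAlgebra.single (wordProd s j) (1 : ℂ) ⊗ₜ[ℂ]
          (T j m • (List.ofFn fun t => coord H (m t) (i t)).prod) := by
      intro m
      by_cases hT : T j m = 0
      · simp [hT]
      · rw [hsupp j m hT, TensorProduct.tmul_smul]
    simp only [h1, ← TensorProduct.tmul_smul, ← TensorProduct.tmul_sum]
    congr 1
    funext σ
    simp only [Finset.sum_apply, Pi.smul_apply, prod_ofFn_coord, comp_perm_eq_iff _ j,
      smul_eq_mul, mul_ite, mul_one, mul_zero, Finset.sum_ite_eq, Finset.sum_ite_eq',
      Finset.mem_univ, if_true]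
    have hj : σ ∘ (σ : Equiv.Perm V).symm ∘ j = j := by funext t; simp
    have h := hinv σ σ.2 ((σ : Equiv.Perm V).symm ∘ j) i
    rwa [hj] at h

end Semidirect

/-! ### The span of the counting maps. -/

section Span

variable {V Γ : Type u} [Group Γ] {k l : ℕ}

/-- The entries of `hatT G K` are invariant under the automorphisms of `G`. -/
lemma hatT_invariant (G : LoopGraph V) (K : BilabelledGraph.{u} k l) {σ : Equiv.Perm V}
    (hσ : σ ∈ G.Aut) (j : Fin l → V) (i : Fin k → V) :
    hatT G K (σ ∘ j) (σ ∘ i) = hatT G K j i := by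
  simp only [hatT, Matrix.of_apply]
  congr 1
  -- Composition with `σ` is a bijection between the two sets of homomorphisms being counted.
  refine (Nat.card_congr ((Equiv.arrowCongr (Equiv.refl K.V) σ).subtypeEquiv fun φ => ?_)).symm
  have h1 : K.graph.IsHom G φ ↔ K.graph.IsHom G (σ ∘ φ) :=
    forall₂_congr fun v w => imp_congr_right fun _ => hσ _ _
  have h2 : Function.Injective φ ↔ Function.Injective (σ ∘ φ) :=
    (σ.injective.of_comp_iff φ).symm
  have h3 : ∀ {m : ℕ} (a : Fin m → K.V) (i : Fin m → V),
      (∀ t, φ (a t) = i t) ↔ ∀ t, (σ ∘ φ) (a t) = (σ ∘ i) t :=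
    fun a i => forall_congr' fun t => σ.injective.eq_iff.symm
  rw [h1, h2, h3 K.inp, h3 K.out]
  rfl

/-- The entries of `hatT G K` vanish at the pairs of words with different values. -/
lemma wordProd_eq_of_hatT_ne_zero {G : LoopGraph V} {s : V → Γ} {K : BilabelledGraph.{u} k l}
    (hK : K ∈ injectiveBalanced G s k l) {j : Fin l → V} {i : Fin k → V}
    (h : hatT G K j i ≠ 0) : wordProd s i = wordProd s j := by
  simp only [hatT, Matrix.of_apply, Nat.cast_ne_zero] at h
  obtain ⟨⟨φ, hφ, hinj, hi, ho⟩⟩ := (Nat.card_ne_zero.mp h).1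
  have h1 : φ ∘ K.inp = i := funext hi
  have h2 : φ ∘ K.out = j := funext ho
  rw [← h1, ← h2]
  exact hK φ hφ hinj

variable [Fintype V]

/-- The graph `G` with inputs `i` and outputs `j`. -/
def LoopGraph.labelled (G : LoopGraph V) (i : Fin k → V) (j : Fin l → V) :
    BilabelledGraph.{u} k l where
  V := V
  finite := inferInstance
  graph := G
  inp := i
  out := j

variable [DecidableEq V]

open Classical in
/-- The injective endomorphisms of a finite graph are its automorphisms. -/
lemma hatT_labelled (G : LoopGraph V) (i i' : Fin k → V) (j j' : Fin l → V) :
    hatT G (G.labelled i j) j' i' =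
      ∑ σ : G.Aut, if j = (σ : Equiv.Perm V).symm ∘ j' ∧ i = (σ : Equiv.Perm V).symm ∘ i'
        then 1 else 0 := by
  rw [Finset.sum_boole, ← Fintype.card_subtype, ← Nat.card_eq_fintype_card]
  simp only [hatT, Matrix.of_apply]
  congr 1
  symm
  refine Nat.card_congr (Equiv.ofBijective (fun σ => ⟨((σ : G.Aut) : Equiv.Perm V),
    fun v w h => (σ.1.2 v w).mp h, (σ.1 : Equiv.Perm V).injective, ?_, ?_⟩) ⟨?_, ?_⟩)
  · exact congrFun ((Semidirect.comp_perm_eq_iff _ _ _).mpr σ.2.2)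
  · exact congrFun ((Semidirect.comp_perm_eq_iff _ _ _).mpr σ.2.1)
  · intro σ τ h
    exact Subtype.ext (Subtype.ext (DFunLike.coe_injective (congrArg Subtype.val h)))
  · rintro ⟨φ, hφ, hinj, hi, ho⟩
    let σ : Equiv.Perm V := Equiv.ofBijective φ (Finite.injective_iff_bijective.mp hinj)
    exact ⟨⟨⟨σ, LoopGraph.mem_Aut_of_isHom (σ := σ) hφ⟩,
      (Semidirect.comp_perm_eq_iff σ _ _).mp (funext ho),
      (Semidirect.comp_perm_eq_iff σ _ _).mp (funext hi)⟩, rfl⟩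

open Classical in
/-- An invariant matrix is a combination of the maps given by labellings of `G`. -/
lemma card_smul_eq_sum_hatT {G : LoopGraph V} {T : TensorMap V k l}
    (hT : ∀ σ ∈ G.Aut, ∀ j i, T (σ ∘ j) (σ ∘ i) = T j i) :
    (Fintype.card G.Aut : ℂ) • T = ∑ j, ∑ i, T j i • hatT G (G.labelled i j) := by
  ext j' i'
  simp only [Matrix.sum_apply, Matrix.smul_apply, hatT_labelled, smul_eq_mul, Finset.mul_sum]
  -- Each `σ` selects one pair `(j, i)`, the preimage of `(j', i')`, whose coefficient is `T j' i'`
  -- by invariance. Summing over `σ` yields the factor `|Aut G|`.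
  have h : ∀ j, ∑ i, ∑ σ : G.Aut, T j i * (if j = (σ : Equiv.Perm V).symm ∘ j' ∧
      i = (σ : Equiv.Perm V).symm ∘ i' then 1 else 0) =
      ∑ σ : G.Aut, if j = (σ : Equiv.Perm V).symm ∘ j' then T j' i' else 0 := by
    intro j
    rw [Finset.sum_comm]
    refine Finset.sum_congr rfl fun σ _ => ?_
    by_cases hj : j = (σ : Equiv.Perm V).symm ∘ j'
    · have h : T ((σ : Equiv.Perm V).symm ∘ j') ((σ : Equiv.Perm V).symm ∘ i') = T j' i' :=
        hT _ (inv_mem σ.2) j' i'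
      simp [hj, h]
    · simp [hj]
  refine Eq.trans ?_ (Finset.sum_congr rfl fun j _ => h j).symm
  rw [Finset.sum_comm]
  simp

/-- A family of bilabelled graphs whose injective homomorphisms to `G` are balanced and which
contains the balanced labellings of `G` spans the intertwiners of the semidirect product. -/
lemma spanAt_eq_mor {G : LoopGraph V} {s : V → Γ} (hs : ∀ i, s i * s i = 1)
    (hgen : Subgroup.closure (Set.range s) = ⊤)
    (hact : ∀ σ : G.Aut, ∃ φ : Γ →* Γ, ∀ i, φ (s i) = s ((σ : Equiv.Perm V) i))
    (C : GraphFamily.{u}) (hC : ∀ k l, C k l ⊆ injectiveBalanced G s k l)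
    (hG : ∀ {k l : ℕ} (i : Fin k → V) (j : Fin l → V), wordProd s i = wordProd s j →
      G.labelled i j ∈ C k l) (k l : ℕ) :
    C.spanAt G k l = (dualSemidirect s G.Aut hs hgen hact).Mor k l := by
  classical
  have hmem : ∀ T, T ∈ (dualSemidirect s G.Aut hs hgen hact).Mor k l ↔ _ :=
    Semidirect.intertwines_iff_invariant
  apply le_antisymm
  · refine Submodule.span_le.mpr ?_
    rintro _ ⟨K, hK, rfl⟩
    exact (hmem _).mpr ⟨fun _ _ => wordProd_eq_of_hatT_ne_zero (hC k l hK),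
      fun σ hσ => hatT_invariant G K hσ⟩
  · intro T hT
    obtain ⟨hsupp, hinv⟩ := (hmem T).mp hT
    have hcard : (Fintype.card G.Aut : ℂ) ≠ 0 := Nat.cast_ne_zero.mpr Fintype.card_ne_zero
    rw [← inv_smul_smul₀ hcard T, card_smul_eq_sum_hatT hinv]
    refine Submodule.smul_mem _ _ (sum_mem fun j _ => sum_mem fun i _ => ?_)
    -- Only labellings with nonzero coefficient need to lie in the family, and the support condition
    -- makes those balanced.
    by_cases h : T j i = 0
    · rw [h, zero_smul]
      exact zero_mem _
    · exact Submodule.smul_mem _ _ (Submodule.subset_span ⟨_, hG i j (hsupp j i h), rfl⟩)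

end Span

/-! ### Invariant quotients of the free product and the conclusion. -/

namespace FreeZ2

variable {V : Type u} {A : Subgroup (FreeZ2 V)} [A.Normal] {k l : ℕ}

lemma quotGen_mul_self (i : V) : quotGen A i * quotGen A i = 1 := by
  rw [quotGen, ← map_mul, gen_mul_self, map_one]

/-- A map of the generators that preserves `A` preserves the equality of words modulo `A`. -/
lemma wordProd_comp_eq {φ : V → V} (hφ : A.map (map φ) ≤ A) {i : Fin k → V} {j : Fin l → V}
    (h : wordProd (quotGen A) i = wordProd (quotGen A) j) :
    wordProd (quotGen A) (φ ∘ i) = wordProd (quotGen A) (φ ∘ j) := by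
  have hq : ⇑(QuotientGroup.map A A (map φ) (Subgroup.map_le_iff_le_comap.mp hφ)) ∘ quotGen A =
      quotGen A ∘ φ := by
    funext v
    change QuotientGroup.map A A _ _ (QuotientGroup.mk (gen v)) = _
    rw [QuotientGroup.map_mk, map_gen]
    rfl
  have := congrArg (QuotientGroup.map A A (map φ) (Subgroup.map_le_iff_le_comap.mp hφ)) h
  rwa [map_wordProd, map_wordProd, hq] at this

end FreeZ2

theorem mainTheorem11 {V : Type u} [Fintype V] [DecidableEq V] (G : LoopGraph V)
    (A : Subgroup (FreeZ2 V)) [A.Normal] (hA : FreeZ2.AutInvariant G A) :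
    (∃ C : GraphFamily.{u}, IsSkewGraphCategory C ∧
      ∀ k l : ℕ, C.spanAt G k l = (FreeZ2.semidirectAut G A hA).Mor k l) ∧
    (FreeZ2.EndInvariant G A →
      ∃ C : GraphFamily.{u}, IsSkewGraphCategory C ∧ IsGroupTheoretical C ∧
        ∀ k l : ℕ, C.spanAt G k l = (FreeZ2.semidirectAut G A hA).Mor k l) := by
  refine ⟨⟨injectiveBalanced G (FreeZ2.quotGen A),
    isSkewGraphCategory_injectiveBalanced G FreeZ2.quotGen_mul_self,
    spanAt_eq_mor _ _ _ _ (fun _ _ => subset_rfl) fun i j h φ hφ hinj => ?_⟩, fun hE => ?_⟩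
  -- An injective endomorphism of `G` is an automorphism, so Aut-invariance keeps the labelling
  -- balanced under it.
  · exact FreeZ2.wordProd_comp_eq (hA (Equiv.ofBijective φ (Finite.injective_iff_bijective.mp hinj))
      (LoopGraph.mem_Aut_of_isHom hφ)) h
  · have hC := isGroupTheoretical_homBalanced G (FreeZ2.quotGen_mul_self (A := A))
    -- The homomorphisms from a labelling of `G` are now arbitrary endomorphisms, which is what
    -- End-invariance covers.
    exact ⟨_, hC.isSkewGraphCategory, hC,
      spanAt_eq_mor _ _ _ _ (homBalanced_subset_injectiveBalanced G)
        fun i j h φ hφ => FreeZ2.wordProd_comp_eq (hE φ hφ) h⟩
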